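/- A graph is a simple undirected graph, and "countable" means that the vertex set is finite or countably infinite. A graph is rigid if its only endomorphism (edge-preserving map of its vertex set to itself) is the identity. Let $K_\omega$ denote the complete graph on countably infinitely many vertices. Theorem. For every countable graph $G$ that does not contain $K_\omega$ as a subgraph there exists a countable rigid graph $G'$ that contains $G$ as an induced subgraph (up to isomorphism). -/

import Mathlib

/-- A graph is rigid if its only endomorphism (graph homomorphism to itself) is the identity. -/
def SimpleGraph.IsRigid {V : Type*} (G : SimpleGraph V) : Prop :=
  ∀ f : G →g G, f = SimpleGraph.Hom.id

universe u

/-! Let `B` be the layered graph, which is rigid and has no infinite clique, and let `T` be the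
clique tree of the disjoint union of `G` and `B`. Mapping `T` to that union would build an infinite
clique (`cliqueTree_isEmpty_hom`), so `T` maps neither to `G` nor to `B`. Conversely, a map from `B`
to `T` would trace an infinite branch, again an infinite clique
(`layeredGraph.isEmpty_hom_cliqueTree`).

`G'` is the disjoint union of `T`, `G` and `B`, with each vertex of `T` and `G` joined to two
private, distant vertices of `B`. These links lie in no triangle, whereas `T` and `B` are connected
and all their edges lie in triangles. So an endomorphism sends each of `T` and `B` into one piece.
The missing homomorphisms force `B` into itself, where it is fixed pointwise, and the links then fix
everything else (`isRigid_attach`). -/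

namespace SimpleGraph

/-! ### Triangles, connectedness and infinite cliques -/

section General

variable {α : Type*}

/-- Every edge lies in a triangle. -/
def EdgesInTriangles (G : SimpleGraph α) : Prop :=
  ∀ x y, G.Adj x y → ∃ z, G.Adj x z ∧ G.Adj y z

/-- A two-valued labelling that is constant along edges is constant on a preconnected graph. -/
theorem Preconnected.iff_of_adj {G : SimpleGraph α} (hG : G.Preconnected) (p : α → Prop)
    (hp : ∀ x y, G.Adj x y → (p x ↔ p y)) (x y : α) : p x ↔ p y := by
  obtain ⟨w⟩ := hG x y
  induction w with
  | nil => exact Iff.rfl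
  | cons h _ ih => exact (hp _ _ h).trans ih

theorem isContained_top_of_seq {G : SimpleGraph α} (x : ℕ → α)
    (hx : ∀ i j, i < j → G.Adj (x i) (x j)) : (⊤ : SimpleGraph ℕ).IsContained G := by
  let f : (⊤ : SimpleGraph ℕ) →g G :=
    ⟨x, fun {a b} h => by
      rcases lt_or_gt_of_ne (show a ≠ b from h) with h | h
      · exact hx _ _ h
      · exact (hx _ _ h).symm⟩
  exact ⟨⟨f, Hom.injective_of_top_hom f⟩⟩

/-- A graph without infinite cliques admits no infinite process extending finite cliques. -/
theorem not_forall_extend_clique {G : SimpleGraph α}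
    (hG : ¬ (⊤ : SimpleGraph ℕ).IsContained G) (P : List α → Prop)
    (hclique : ∀ t, P t → t.Pairwise G.Adj) (hnil : P [])
    (hext : ∀ t, P t → ∃ x, P (x :: t)) : False := by
  have : Nonempty α := ⟨(hext [] hnil).choose⟩
  choose! g hg using hext
  let t : ℕ → List α := fun n => Nat.rec [] (fun _ l => g l :: l) n
  have ht : ∀ n, P (t n) := by
    intro n
    induction n with
    | zero => exact hnil
    | succ n ih => exact hg _ ih
  have hmem : ∀ i j, i < j → g (t i) ∈ t j := by
    intro i j hij
    induction hij with
    | refl => exact List.mem_cons_self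
    | step _ ih => exact List.mem_cons_of_mem _ ih
  refine hG (isContained_top_of_seq (fun n => g (t n)) fun i j hij => ?_)
  have h := hclique _ (ht (j + 1))
  exact ((List.pairwise_cons.1 h).1 _ (hmem i j hij)).symm

end General

/-! ### The tree of finite cliques -/

section CliqueTree

variable {α : Type*}

/-- The comparability graph of the tree of finite cliques of `G`, listed in all orders, together
with an apex. -/
def cliqueTree (G : SimpleGraph α) : SimpleGraph (Option {l : List α // l.Pairwise G.Adj}) where
  Adj
    | none, none => False
    | none, some _ => True
    | some _, none => True
    | some l, some m => l ≠ m ∧ (l.1 <:+ m.1 ∨ m.1 <:+ l.1)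
  symm := ⟨by
    rintro (_ | l) (_ | m) h
    · exact h
    · trivial
    · trivial
    · exact ⟨h.1.symm, h.2.symm⟩⟩
  loopless := ⟨by
    rintro (_ | l) h
    · exact h
    · exact h.1 rfl⟩

theorem cliqueTree_adj_none_some (G : SimpleGraph α) (l : {l : List α // l.Pairwise G.Adj}) :
    G.cliqueTree.Adj none (some l) := trivial

theorem cliqueTree_adj_some_some (G : SimpleGraph α) {l m : {l : List α // l.Pairwise G.Adj}} :
    G.cliqueTree.Adj (some l) (some m) ↔ l ≠ m ∧ (l.1 <:+ m.1 ∨ m.1 <:+ l.1) := Iff.rfl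

theorem cliqueTree_preconnected (G : SimpleGraph α) : G.cliqueTree.Preconnected := by
  have h : ∀ x, G.cliqueTree.Reachable none x := by
    rintro (_ | l)
    · exact Reachable.refl _
    · exact (G.cliqueTree_adj_none_some l).reachable
  exact fun x y => (h x).symm.trans (h y)

/-- The apex completes tree edges. An edge at the apex is completed by the root `[]`, or by a
singleton if it ends at the root, whence `Nonempty`. -/
theorem cliqueTree_edgesInTriangles (G : SimpleGraph α) [Nonempty α] :
    G.cliqueTree.EdgesInTriangles := by
  have key : ∀ l, ∃ z, G.cliqueTree.Adj none z ∧ G.cliqueTree.Adj (some l) z := by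
    intro l
    by_cases hl : l.1 = []
    · obtain ⟨a⟩ := ‹Nonempty α›
      refine ⟨some ⟨[a], List.pairwise_singleton _ _⟩, trivial, ?_⟩
      rw [cliqueTree_adj_some_some]
      refine ⟨fun h => ?_, Or.inl ?_⟩
      · rw [h] at hl
        simp at hl
      · rw [hl]
        exact List.nil_suffix
    · refine ⟨some ⟨[], List.Pairwise.nil⟩, trivial, ?_⟩
      rw [cliqueTree_adj_some_some]
      refine ⟨fun h => hl ?_, Or.inr List.nil_suffix⟩
      rw [h]
  rintro (_ | l) (_ | m) h
  · exact h.elim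
  · exact key m
  · obtain ⟨z, h₁, h₂⟩ := key l
    exact ⟨z, h₂, h₁⟩
  · exact ⟨none, trivial, trivial⟩

/-- The tree of finite cliques of a graph without infinite cliques does not map to the graph. -/
theorem cliqueTree_isEmpty_hom {G : SimpleGraph α}
    (hG : ¬ (⊤ : SimpleGraph ℕ).IsContained G) : IsEmpty (G.cliqueTree →g G) := by
  refine ⟨fun f => ?_⟩
  -- All entries of `t` are values of `f` at proper suffixes of `t`, hence adjacent to `f t`, which
  -- can be prepended.
  refine not_forall_extend_clique hG
    (fun t => t.Pairwise G.Adj ∧ ∀ x ∈ t, ∃ s : {l : List α // l.Pairwise G.Adj},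
      s.1 <:+ t ∧ s.1 ≠ t ∧ f (some s) = x) (fun t h => h.1) ⟨List.Pairwise.nil, by simp⟩ ?_
  rintro t ⟨ht, h⟩
  refine ⟨f (some ⟨t, ht⟩), List.pairwise_cons.2 ⟨fun x hx => ?_, ht⟩, fun x hx => ?_⟩
  · obtain ⟨s, hs, hne, rfl⟩ := h x hx
    refine f.map_adj (G.cliqueTree_adj_some_some.2 ⟨fun e => hne ?_, Or.inr hs⟩)
    rw [← e]
  · have hlen : ∀ s y, s <:+ t → s ≠ y :: t := by
      intro s y hs e
      have := hs.length_le
      rw [e] at this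
      simp at this
    rcases List.mem_cons.1 hx with rfl | hx
    · exact ⟨⟨t, ht⟩, List.suffix_cons _ _, hlen _ _ (List.suffix_refl t), rfl⟩
    · obtain ⟨s, hs, _, e⟩ := h x hx
      exact ⟨s, hs.trans (List.suffix_cons _ _), hlen _ _ hs, e⟩

theorem eq_of_cons_suffix {x y : α} {t l : List α} (hx : x :: t <:+ l) (hy : y :: t <:+ l) :
    x = y := by
  have := List.suffix_of_suffix_length_le hx hy (by simp)
  have := this.eq_of_length (by simp)
  exact (List.cons.inj this).1

end CliqueTree

/-! ### The rigid layered graph -/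

section Layered

/-- Vertices of the layered graph: a hub, and layers of sizes `7, 8, 9, …`. -/
abbrev LayeredVertex : Type := Option {p : ℕ × ℕ // p.2 < p.1 + 7}

/-- A hub and complete layers of sizes `7, 8, 9, …`, with consecutive layers joined by a path;
the hub is joined to the first vertex of each layer and to the second vertex of the first one. -/
def layeredGraph : SimpleGraph LayeredVertex where
  Adj
    | none, none => False
    | none, some p => p.1.2 = 0 ∨ (p.1.1 = 0 ∧ p.1.2 = 1)
    | some p, none => p.1.2 = 0 ∨ (p.1.1 = 0 ∧ p.1.2 = 1)
    | some p, some q => (p.1.1 = q.1.1 ∧ p.1.2 ≠ q.1.2) ∨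
        (q.1.1 = p.1.1 + 1 ∧ (q.1.2 = p.1.2 ∨ q.1.2 = p.1.2 + 1)) ∨
        (p.1.1 = q.1.1 + 1 ∧ (p.1.2 = q.1.2 ∨ p.1.2 = q.1.2 + 1))
  symm := ⟨by
    rintro (_ | l) (_ | m) h
    · exact h
    · exact h
    · exact h
    · dsimp only at h ⊢
      omega⟩
  loopless := ⟨by
    rintro (_ | l) h
    · exact h
    · dsimp only at h
      omega⟩

namespace layeredGraph

/-- The vertex with index `i` in layer `n`. -/
def vertex (n i : ℕ) (h : i < n + 7) : LayeredVertex := some ⟨(n, i), h⟩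

theorem eq_none_or_vertex (x : LayeredVertex) : x = none ∨ ∃ n i h, x = vertex n i h := by
  rcases x with _ | ⟨⟨n, i⟩, h⟩
  · exact Or.inl rfl
  · exact Or.inr ⟨n, i, h, rfl⟩

theorem vertex_inj {n i m j : ℕ} {h : i < n + 7} {h' : j < m + 7} :
    vertex n i h = vertex m j h' ↔ n = m ∧ i = j := by
  simp [vertex]

theorem vertex_ne_none {n i : ℕ} {h : i < n + 7} : vertex n i h ≠ none := by
  simp [vertex]

theorem adj_none_none : ¬ layeredGraph.Adj none none := layeredGraph.irrefl

theorem adj_none_vertex {n i : ℕ} {h : i < n + 7} :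
    layeredGraph.Adj none (vertex n i h) ↔ i = 0 ∨ (n = 0 ∧ i = 1) := Iff.rfl

theorem adj_vertex_none {n i : ℕ} {h : i < n + 7} :
    layeredGraph.Adj (vertex n i h) none ↔ i = 0 ∨ (n = 0 ∧ i = 1) := Iff.rfl

theorem adj_vertex {n i m j : ℕ} {h : i < n + 7} {h' : j < m + 7} :
    layeredGraph.Adj (vertex n i h) (vertex m j h') ↔ (n = m ∧ i ≠ j) ∨
      (m = n + 1 ∧ (j = i ∨ j = i + 1)) ∨ (n = m + 1 ∧ (i = j ∨ i = j + 1)) := Iff.rfl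

theorem preconnected : layeredGraph.Preconnected := by
  have h : ∀ x, layeredGraph.Reachable none x := by
    intro x
    rcases eq_none_or_vertex x with rfl | ⟨n, i, h, rfl⟩
    · exact Reachable.refl _
    · have h0 : layeredGraph.Adj none (vertex n 0 (by omega)) := by simp [adj_none_vertex]
      by_cases hi : i = 0
      · subst hi
        exact h0.reachable
      · refine h0.reachable.trans (Adj.reachable ?_)
        rw [adj_vertex]
        omega
  exact fun x y => (h x).symm.trans (h y)

theorem edgesInTriangles : layeredGraph.EdgesInTriangles := by
  have hub : ∀ n i h, layeredGraph.Adj none (vertex n i h) →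
      ∃ z, layeredGraph.Adj none z ∧ layeredGraph.Adj (vertex n i h) z := by
    intro n i h hadj
    rw [adj_none_vertex] at hadj
    refine ⟨vertex (n + (1 - i)) 0 (by omega), ?_, ?_⟩
    · simp [adj_none_vertex]
    · rw [adj_vertex]
      omega
  intro x y hxy
  rcases eq_none_or_vertex x with rfl | ⟨n, i, h, rfl⟩
  · rcases eq_none_or_vertex y with rfl | ⟨m, j, h', rfl⟩
    · exact (adj_none_none hxy).elim
    · exact hub _ _ _ hxy
  rcases eq_none_or_vertex y with rfl | ⟨m, j, h', rfl⟩
  · obtain ⟨z, h₁, h₂⟩ := hub _ _ _ hxy.symm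
    exact ⟨z, h₂, h₁⟩
  rw [adj_vertex] at hxy
  rcases hxy with ⟨rfl, hij⟩ | ⟨rfl, hij⟩ | ⟨rfl, hij⟩
  · obtain ⟨k, hk, hki, hkj⟩ : ∃ k, k < n + 7 ∧ k ≠ i ∧ k ≠ j := by
      by_cases h0 : 0 ≠ i ∧ 0 ≠ j
      · exact ⟨0, by omega, h0⟩
      · by_cases h1 : 1 ≠ i ∧ 1 ≠ j
        · exact ⟨1, by omega, h1⟩
        · exact ⟨2, by omega, by omega, by omega⟩
    refine ⟨vertex n k hk, ?_, ?_⟩ <;> rw [adj_vertex] <;> omega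
  · refine ⟨vertex (n + 1) (2 * i + 1 - j) (by omega), ?_, ?_⟩ <;> rw [adj_vertex] <;> omega
  · refine ⟨vertex (m + 1) (2 * j + 1 - i) (by omega), ?_, ?_⟩ <;> rw [adj_vertex] <;> omega

/-- Adjacent vertices outside a common layer have at most four common neighbours. -/
theorem exists_card_le_of_adj {x y : LayeredVertex} (hxy : layeredGraph.Adj x y)
    (hl : ¬ ∃ n i h j h', x = vertex n i h ∧ y = vertex n j h') :
    ∃ S : Finset LayeredVertex, S.card ≤ 4 ∧
      ∀ z, layeredGraph.Adj x z → layeredGraph.Adj y z → z ∈ S := by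
  have hub : ∀ n i h, layeredGraph.Adj none (vertex n i h) →
      ∃ S : Finset LayeredVertex, S.card ≤ 4 ∧
        ∀ z, layeredGraph.Adj none z → layeredGraph.Adj (vertex n i h) z → z ∈ S := by
    intro n i h _
    refine ⟨{vertex (n - 1) 0 (by omega), vertex n 0 (by omega), vertex (n + 1) 0 (by omega),
      vertex 0 1 (by omega)}, Finset.card_le_four, ?_⟩
    intro z h₁ h₂
    rcases eq_none_or_vertex z with rfl | ⟨m, j, h', rfl⟩
    · exact (adj_none_none h₁).elim
    · rw [adj_none_vertex] at h₁
      rw [adj_vertex] at h₂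
      simp only [Finset.mem_insert, Finset.mem_singleton, vertex_inj]
      omega
  have step : ∀ n i h j h', layeredGraph.Adj (vertex n i h) (vertex (n + 1) j h') →
      ∃ S : Finset LayeredVertex, S.card ≤ 4 ∧
        ∀ z, layeredGraph.Adj (vertex n i h) z → layeredGraph.Adj (vertex (n + 1) j h') z →
          z ∈ S := by
    intro n i h j h' hadj
    rw [adj_vertex] at hadj
    -- Since `j` is `i` or `i + 1`, the index `2 * i + 1 - j` is the other of the two; `min` only
    -- keeps the index in range.
    refine ⟨{none, vertex n (min j (n + 6)) (by omega), vertex n (j - 1) (by omega),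
      vertex (n + 1) (2 * i + 1 - j) (by omega)}, Finset.card_le_four, ?_⟩
    intro z h₁ h₂
    rcases eq_none_or_vertex z with rfl | ⟨m, k, h', rfl⟩
    · simp
    · rw [adj_vertex] at h₁ h₂
      simp only [Finset.mem_insert, Finset.mem_singleton, vertex_inj, vertex_ne_none, false_or]
      omega
  rcases eq_none_or_vertex x with rfl | ⟨n, i, h, rfl⟩
  · rcases eq_none_or_vertex y with rfl | ⟨m, j, h', rfl⟩
    · exact (adj_none_none hxy).elim
    · exact hub _ _ _ hxy
  rcases eq_none_or_vertex y with rfl | ⟨m, j, h', rfl⟩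
  · obtain ⟨S, hS, H⟩ := hub _ _ _ hxy.symm
    exact ⟨S, hS, fun z h₁ h₂ => H z h₂ h₁⟩
  rcases adj_vertex.1 hxy with ⟨rfl, hij⟩ | ⟨rfl, hij⟩ | ⟨rfl, hij⟩
  · exact (hl ⟨_, _, _, _, _, rfl, rfl⟩).elim
  · exact step _ _ _ _ _ hxy
  · obtain ⟨S, hS, H⟩ := step _ _ _ _ _ hxy.symm
    exact ⟨S, hS, fun z h₁ h₂ => H z h₂ h₁⟩

/-- A clique with at least seven vertices is contained in a layer. -/
theorem exists_layer {N : ℕ} (hN : 7 ≤ N) (g : (⊤ : SimpleGraph (Fin N)) →g layeredGraph) :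
    ∃ n, N ≤ n + 7 ∧ ∀ k, ∃ i h, g k = vertex n i h := by
  have hinj : Function.Injective g := Hom.injective_of_top_hom g
  have hadj : ∀ a b, a ≠ b → layeredGraph.Adj (g a) (g b) := fun a b h => g.map_adj h
  have same : ∀ a b, a ≠ b → ∃ n i h j h', g a = vertex n i h ∧ g b = vertex n j h' := by
    intro a b hab
    by_contra hl
    obtain ⟨S, hS, H⟩ := exists_card_le_of_adj (hadj a b hab) hl
    -- The other `N - 2 ≥ 5` clique vertices are common neighbours, too many for `S`; hence layers
    -- start at size 7.
    have hsub : ((Finset.univ.erase a).erase b).image g ⊆ S := by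
      intro z hz
      simp only [Finset.mem_image, Finset.mem_erase, Finset.mem_univ, and_true] at hz
      obtain ⟨c, ⟨hb, ha⟩, rfl⟩ := hz
      exact H _ (hadj _ _ ha.symm) (hadj _ _ hb.symm)
    have h1 := Finset.card_le_card hsub
    rw [Finset.card_image_of_injective _ hinj, Finset.card_erase_of_mem (by simp [hab.symm]),
      Finset.card_erase_of_mem (by simp), Finset.card_univ, Fintype.card_fin] at h1
    omega
  obtain ⟨n, i₀, h₀, _, _, e₀, -⟩ := same ⟨0, by omega⟩ ⟨1, by omega⟩ (by simp)
  have hall : ∀ k, ∃ i h, g k = vertex n i h := by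
    intro k
    by_cases hk : (⟨0, by omega⟩ : Fin N) = k
    · subst hk
      exact ⟨_, _, e₀⟩
    · obtain ⟨m, i, h, j, h', e₁, e₂⟩ := same _ _ hk
      rw [e₀, vertex_inj] at e₁
      obtain ⟨rfl, -⟩ := e₁
      exact ⟨_, _, e₂⟩
  refine ⟨n, ?_, hall⟩
  choose i h e using hall
  have : Function.Injective fun k => (⟨i k, h k⟩ : Fin (n + 7)) := by
    intro a b hab
    apply hinj
    rw [e, e, vertex_inj]
    exact ⟨rfl, congrArg Fin.val hab⟩
  simpa using Fintype.card_le_of_injective _ this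

theorem not_isContained_top : ¬ (⊤ : SimpleGraph ℕ).IsContained layeredGraph := by
  rintro ⟨c⟩
  let g (N : ℕ) : (⊤ : SimpleGraph (Fin N)) →g layeredGraph :=
    ⟨fun k => c.toHom k.1, fun {a b} h => c.toHom.map_adj (by
      simpa [Fin.ext_iff] using h)⟩
  obtain ⟨n, -, h⟩ := exists_layer le_rfl (g 7)
  obtain ⟨m, hm, h'⟩ := exists_layer (show 7 ≤ n + 8 by omega) (g (n + 8))
  obtain ⟨i, hi, e⟩ := h 0
  obtain ⟨j, hj, e'⟩ := h' 0
  have : vertex n i hi = vertex m j hj := e.symm.trans e'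
  rw [vertex_inj] at this
  omega

/-- The inclusion of a layer. -/
def layerHom (n : ℕ) : (⊤ : SimpleGraph (Fin (n + 7))) →g layeredGraph :=
  ⟨fun k => vertex n k.1 k.2, fun {a b} h => by
    have : a.1 ≠ b.1 := fun e => h (Fin.ext e)
    rw [adj_vertex]
    omega⟩

/-- Layers are large cliques, so each maps into one at least as large. The hub is adjacent to
arbitrarily late layers, so it cannot move into a layer. Only layer 0 has two hub neighbours, so it
is preserved; adjacency of consecutive layers preserves the rest. -/
theorem isRigid : layeredGraph.IsRigid := by
  intro f
  have h₁ : ∀ n, ∃ m, n ≤ m ∧ ∀ i h, ∃ j h', f (vertex n i h) = vertex m j h' := by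
    intro n
    obtain ⟨m, hm, h⟩ := exists_layer (by omega) (f.comp (layerHom n))
    exact ⟨m, by omega, fun i hi => h ⟨i, hi⟩⟩
  choose φ hφ hf using h₁
  have hnone : f none = none := by
    rcases eq_none_or_vertex (f none) with h | ⟨m, j, h, e⟩
    · exact h
    · have hadj : layeredGraph.Adj none (vertex (m + 2) 0 (by omega)) := by
        simp [adj_none_vertex]
      have := f.map_adj hadj
      obtain ⟨k, hk, e'⟩ := hf (m + 2) 0 (by omega)
      rw [e, e', adj_vertex] at this
      have := hφ (m + 2)
      omega
  have hlayer : ∀ n, φ n = n := by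
    intro n
    induction n with
    | zero =>
      obtain ⟨j₀, h₀, e₀⟩ := hf 0 0 (by omega)
      obtain ⟨j₁, h₁, e₁⟩ := hf 0 1 (by omega)
      have a₀ := f.map_adj (show layeredGraph.Adj none (vertex 0 0 (by omega)) by
        simp [adj_none_vertex])
      have a₁ := f.map_adj (show layeredGraph.Adj none (vertex 0 1 (by omega)) by
        simp [adj_none_vertex])
      have a₂ := f.map_adj (show layeredGraph.Adj (vertex 0 0 (by omega))
        (vertex 0 1 (by omega)) by simp [adj_vertex])
      rw [hnone, e₀, adj_none_vertex] at a₀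
      rw [hnone, e₁, adj_none_vertex] at a₁
      rw [e₀, e₁, adj_vertex] at a₂
      omega
    | succ n ih =>
      obtain ⟨j₀, h₀, e₀⟩ := hf n 0 (by omega)
      obtain ⟨j₁, h₁, e₁⟩ := hf (n + 1) 0 (by omega)
      have a := f.map_adj (show layeredGraph.Adj (vertex n 0 (by omega))
        (vertex (n + 1) 0 (by omega)) by simp [adj_vertex])
      rw [e₀, e₁, adj_vertex] at a
      have := hφ (n + 1)
      omega
  simp only [hlayer] at hf
  -- Two consecutive layers are fixed together, by induction on the index starting from their hub
  -- neighbours.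
  have hind : ∀ n i (h : i < n + 7), f (vertex n i h) = vertex n i h ∧
      f (vertex (n + 1) i (by omega)) = vertex (n + 1) i (by omega) := by
    intro n i
    have hlow : ∀ i (h : i < n + 7),
        f (vertex (n + 1) i (by omega)) = vertex (n + 1) i (by omega) →
        (∀ k, k + 1 = i → ∀ hk, f (vertex n k hk) = vertex n k hk) →
        f (vertex n i h) = vertex n i h := by
      intro i h e hprev
      obtain ⟨j, hj, e'⟩ := hf n i h
      have a := f.map_adj (show layeredGraph.Adj (vertex n i h)
        (vertex (n + 1) i (by omega)) by simp [adj_vertex])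
      rw [e, e', adj_vertex] at a
      rw [e', vertex_inj]
      refine ⟨rfl, ?_⟩
      by_contra hne
      have hji : j + 1 = i := by omega
      have a' := f.map_adj (show layeredGraph.Adj (vertex n j hj) (vertex n i h) by
        rw [adj_vertex]
        omega)
      rw [hprev j hji hj, e'] at a'
      exact layeredGraph.irrefl a'
    induction i with
    | zero =>
      intro h
      have e : f (vertex (n + 1) 0 (by omega)) = vertex (n + 1) 0 (by omega) := by
        obtain ⟨j, hj, e⟩ := hf (n + 1) 0 (by omega)
        have a := f.map_adj (show layeredGraph.Adj none (vertex (n + 1) 0 (by omega)) by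
          simp [adj_none_vertex])
        rw [hnone, e, adj_none_vertex] at a
        rw [e, vertex_inj]
        omega
      exact ⟨hlow 0 h e (by omega), e⟩
    | succ i ih =>
      intro h
      obtain ⟨e₁, e₂⟩ := ih (by omega)
      have e : f (vertex (n + 1) (i + 1) (by omega)) = vertex (n + 1) (i + 1) (by omega) := by
        obtain ⟨j, hj, e⟩ := hf (n + 1) (i + 1) (by omega)
        have a := f.map_adj (show layeredGraph.Adj (vertex n i (by omega))
          (vertex (n + 1) (i + 1) (by omega)) by simp [adj_vertex])
        have a' := f.map_adj (show layeredGraph.Adj (vertex (n + 1) i (by omega))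
          (vertex (n + 1) (i + 1) (by omega)) by simp [adj_vertex])
        rw [e₁, e, adj_vertex] at a
        rw [e₂, e, adj_vertex] at a'
        rw [e, vertex_inj]
        omega
      refine ⟨hlow _ h e ?_, e⟩
      intro k hk hk'
      obtain rfl : k = i := by omega
      exact e₁
  ext x
  rcases eq_none_or_vertex x with rfl | ⟨n, i, h, rfl⟩
  · rw [hnone]
    rfl
  · rw [(hind n i h).1]
    rfl

/-! ### From the layered graph to clique trees -/

variable {α : Type*}

/-- The layered graph does not map to the clique tree of a graph without infinite cliques. -/
theorem isEmpty_hom_cliqueTree {H : SimpleGraph α}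
    (hH : ¬ (⊤ : SimpleGraph ℕ).IsContained H) : IsEmpty (layeredGraph →g H.cliqueTree) := by
  classical
  refine ⟨fun f => ?_⟩
  let R (t : List α) (x : LayeredVertex) : Prop := ∃ l, f x = some l ∧ t <:+ l.1
  let bad (t : List α) (n : ℕ) : Finset (Fin (n + 7)) :=
    Finset.univ.filter fun i => ¬ R t (vertex n i.1 i.2)
  have hsub : ∀ (n : ℕ) (S : Finset (Fin (n + 7))) (y), (∀ i ∈ S, f (vertex n i.1 i.2) = y) →
      S.card ≤ 1 := by
    intro n S y hS
    refine Finset.card_le_one.2 fun a ha b hb => ?_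
    by_contra hab
    have := f.map_adj ((layerHom n).map_adj (show (⊤ : SimpleGraph (Fin (n + 7))).Adj a b from hab))
    change H.cliqueTree.Adj (f (vertex n a.1 a.2)) (f (vertex n b.1 b.2)) at this
    rw [hS a ha, hS b hb] at this
    exact H.cliqueTree.irrefl this
  have huniq : ∀ t p q x y, (p = q ∨ layeredGraph.Adj p q) → R (x :: t) p → R (y :: t) q →
      x = y := by
    rintro t p q x y hpq ⟨l, hl, hxl⟩ ⟨m, hm, hym⟩
    have : l.1 <:+ m.1 ∨ m.1 <:+ l.1 := by
      rcases hpq with rfl | hpq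
      · rw [hl] at hm
        obtain rfl := Option.some.inj hm
        exact Or.inl (List.suffix_refl _)
      · have := f.map_adj hpq
        rw [hl, hm] at this
        exact this.2
    rcases this with h | h
    · exact eq_of_cons_suffix (hxl.trans h) hym
    · exact eq_of_cons_suffix hxl (hym.trans h)
  -- Invariant: in all late layers, all but at most `t.length + 1` images lie at or above the node
  -- `t`.
  refine not_forall_extend_clique hH
    (fun t => ∃ N, ∀ n, N ≤ n → (bad t n).card ≤ t.length + 1) ?_ ?_ ?_
  · rintro t ⟨N, hN⟩
    have h1 := hN (N + t.length) (by omega)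
    obtain ⟨i, hi⟩ : ∃ i, i ∉ bad t (N + t.length) := by
      by_contra! h
      rw [Finset.eq_univ_iff_forall.2 h, Finset.card_univ, Fintype.card_fin] at h1
      omega
    simp only [bad, Finset.mem_filter, Finset.mem_univ, true_and, not_not] at hi
    obtain ⟨l, -, hl⟩ := hi
    exact l.2.sublist hl.sublist
  · refine ⟨0, fun n _ => hsub n _ none fun i hi => ?_⟩
    simp only [bad, Finset.mem_filter, Finset.mem_univ, true_and] at hi
    by_contra h
    obtain ⟨l, hl⟩ := Option.ne_none_iff_exists'.1 h
    exact hi ⟨l, hl, List.nil_suffix⟩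
  · rintro t ⟨N, hN⟩
    let far (n : ℕ) : Finset (Fin (n + 7)) :=
      Finset.univ.filter fun i => ¬ ∃ x, R (x :: t) (vertex n i.1 i.2)
    have hfar : ∀ n, N ≤ n → (far n).card ≤ t.length + 2 := by
      intro n hn
      have hle : far n ⊆ bad t n ∪
          Finset.univ.filter fun i : Fin (n + 7) => ∃ l, f (vertex n i.1 i.2) = some l ∧ l.1 = t := by
        intro i hi
        simp only [far, bad, Finset.mem_filter, Finset.mem_univ, true_and, Finset.mem_union] at hi ⊢
        by_contra! h
        obtain ⟨⟨l, hl, s, hs⟩, h'⟩ := h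
        rcases List.eq_nil_or_concat s with rfl | ⟨s, x, rfl⟩
        · exact h' l hl (by simpa using hs.symm)
        · exact hi ⟨x, l, hl, s, by simpa using hs⟩
      refine (Finset.card_le_card hle).trans ((Finset.card_union_le _ _).trans ?_)
      have h1 := hN n hn
      have h2 : (Finset.univ.filter fun i : Fin (n + 7) =>
          ∃ l, f (vertex n i.1 i.2) = some l ∧ l.1 = t).card ≤ 1 := by
        by_cases ht : t.Pairwise H.Adj
        · refine hsub n _ (some ⟨t, ht⟩) fun i hi => ?_
          simp only [Finset.mem_filter, Finset.mem_univ, true_and] at hi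
          obtain ⟨l, hl, rfl⟩ := hi
          exact hl
        · rw [Finset.filter_eq_empty_iff.2]
          · simp
          · rintro i - ⟨l, -, rfl⟩
            exact ht l.2
      omega
    -- At most `2 * (t.length + 2) < n + 7` indices are lost in the two layers. The link carries the
    -- child `x` of `t` from layer to layer.
    have hlink : ∀ n, N + 2 * t.length ≤ n → ∃ (i : ℕ) (h : i < n + 7),
        (∃ x, R (x :: t) (vertex n i h)) ∧ ∃ x, R (x :: t) (vertex (n + 1) i (by omega)) := by
      intro n hn
      by_contra! hcon
      have hle : (Finset.univ : Finset (Fin (n + 7))).map Fin.valEmbedding ⊆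
          (far n).map Fin.valEmbedding ∪ (far (n + 1)).map Fin.valEmbedding := by
        intro i hi
        simp only [Finset.mem_map, Finset.mem_univ, true_and, Fin.valEmbedding_apply] at hi
        obtain ⟨i, rfl⟩ := hi
        simp only [Finset.mem_union, Finset.mem_map, Fin.valEmbedding_apply, far,
          Finset.mem_filter, Finset.mem_univ, true_and]
        by_cases h : ∃ x, R (x :: t) (vertex n i.1 i.2)
        · obtain ⟨x, hx⟩ := h
          refine Or.inr ⟨⟨i.1, by omega⟩, ?_, rfl⟩
          rintro ⟨y, hy⟩
          exact hcon i.1 i.2 ⟨x, hx⟩ y hy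
        · exact Or.inl ⟨i, h, rfl⟩
      have h1 := (Finset.card_le_card hle).trans (Finset.card_union_le _ _)
      rw [Finset.card_map, Finset.card_map, Finset.card_map, Finset.card_univ,
        Fintype.card_fin] at h1
      have h2 := hfar n (by omega)
      have h3 := hfar (n + 1) (by omega)
      omega
    have hlayer : ∀ n i j (hi : i < n + 7) (hj : j < n + 7),
        vertex n i hi = vertex n j hj ∨ layeredGraph.Adj (vertex n i hi) (vertex n j hj) := by
      intro n i j hi hj
      rw [vertex_inj, adj_vertex]
      omega
    obtain ⟨i₀, hi₀, ⟨x, hx⟩, -⟩ := hlink (N + 2 * t.length) le_rfl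
    refine ⟨x, N + 2 * t.length, fun n hn => ?_⟩
    have hconst : ∀ i h y, R (y :: t) (vertex n i h) → x = y := by
      induction n, hn using Nat.le_induction with
      | base => exact fun i h y hy => huniq t _ _ x y (hlayer _ _ _ _ _) hx hy
      | succ n hn ih =>
        intro i h y hy
        obtain ⟨k, hk, ⟨z, hz⟩, w, hw⟩ := hlink n hn
        obtain rfl := ih k hk z hz
        obtain rfl := huniq t _ _ x w (Or.inr (by simp [adj_vertex])) hz hw
        exact huniq t _ _ x y (hlayer _ _ _ _ _) hw hy
    refine (Finset.card_le_card ?_).trans (hfar n (by omega))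
    intro i hi
    simp only [far, bad, Finset.mem_filter, Finset.mem_univ, true_and] at hi ⊢
    rintro ⟨y, hy⟩
    obtain rfl := hconst _ _ _ hy
    exact hi hy

end layeredGraph

end Layered

/-! ### Gluing along triangle-free links -/

section Attach

variable {α β γ : Type*}

/-- The disjoint union of `W` and `B`, with additional edges between them given by `s`. -/
def attach (W : SimpleGraph α) (B : SimpleGraph β) (s : α → β → Prop) :
    SimpleGraph (α ⊕ β) where
  Adj
    | .inl x, .inl y => W.Adj x y
    | .inr x, .inr y => B.Adj x y
    | .inl x, .inr y => s x y
    | .inr y, .inl x => s x y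
  symm := ⟨by
    rintro (x | x) (y | y) h
    · exact Adj.symm h
    · exact h
    · exact h
    · exact Adj.symm h⟩
  loopless := ⟨by
    rintro (x | x) h
    · exact W.irrefl h
    · exact B.irrefl h⟩

/-- A homomorphism from a preconnected graph whose edges lie in triangles does not use
edges between the two sides, provided these lie in no triangle. -/
theorem hom_attach_cases {W : SimpleGraph α} {B : SimpleGraph β} {s : α → β → Prop}
    (hs₁ : ∀ x b b', s x b → s x b' → ¬ B.Adj b b') (hs₂ : ∀ x y b, s x b → s y b → x = y)
    {P : SimpleGraph γ} (hP : P.Preconnected) (hP' : P.EdgesInTriangles)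
    (f : P →g attach W B s) :
    (∃ g : P →g W, ∀ p, f p = .inl (g p)) ∨ ∃ g : P →g B, ∀ p, f p = .inr (g p) := by
  have key : ∀ p q, P.Adj p q → ((f p).isLeft = true ↔ (f q).isLeft = true) := by
    intro p q hpq
    obtain ⟨r, hpr, hqr⟩ := hP' p q hpq
    have h₁ := f.map_adj hpq
    have h₂ := f.map_adj hpr
    have h₃ := f.map_adj hqr
    rcases hp : f p with x | x <;> rcases hq : f q with y | y <;>
      rcases hr : f r with z | z <;> rw [hp, hq] at h₁ <;> rw [hp, hr] at h₂ <;>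
      rw [hq, hr] at h₃ <;> simp only [Sum.isLeft_inl, Sum.isLeft_inr, Bool.false_eq_true,
        iff_false, iff_true, not_true_eq_false]
    · exact W.irrefl (hs₂ x z y h₁ h₃ ▸ h₂)
    · exact hs₁ x y z h₁ h₂ h₃
    · exact W.irrefl (hs₂ y z x h₁ h₂ ▸ h₃)
    · exact hs₁ y x z h₁ h₃ h₂
  have hconst := hP.iff_of_adj (fun p => (f p).isLeft = true) key
  by_cases h : ∀ p, (f p).isLeft = true
  · choose g hg using fun p => Sum.isLeft_iff.1 (h p)
    refine Or.inl ⟨⟨g, fun {p q} hpq => ?_⟩, hg⟩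
    have := f.map_adj hpq
    rw [hg, hg] at this
    exact this
  · have h' : ∀ p, (f p).isRight = true := by
      push Not at h
      obtain ⟨p, hp⟩ := h
      intro q
      have := hconst p q
      rw [← Sum.not_isLeft]
      simpa using fun e => hp (this.2 e)
    choose g hg using fun p => Sum.isRight_iff.1 (h' p)
    refine Or.inr ⟨⟨g, fun {p q} hpq => ?_⟩, hg⟩
    have := f.map_adj hpq
    rw [hg, hg] at this
    exact this

theorem hom_sum_cases {G : SimpleGraph α} {H : SimpleGraph β} {P : SimpleGraph γ}
    (hP : P.Preconnected) (f : P →g G ⊕g H) :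
    (∃ g : P →g G, ∀ p, f p = .inl (g p)) ∨ ∃ g : P →g H, ∀ p, f p = .inr (g p) := by
  have key : ∀ p q, P.Adj p q → ((f p).isLeft = true ↔ (f q).isLeft = true) := by
    intro p q hpq
    have h₁ := f.map_adj hpq
    rcases hp : f p with x | x <;> rcases hq : f q with y | y <;> rw [hp, hq] at h₁ <;>
      simp at h₁ ⊢
  have hconst := hP.iff_of_adj (fun p => (f p).isLeft = true) key
  by_cases h : ∀ p, (f p).isLeft = true
  · choose g hg using fun p => Sum.isLeft_iff.1 (h p)
    refine Or.inl ⟨⟨g, fun {p q} hpq => ?_⟩, hg⟩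
    have := f.map_adj hpq
    rw [hg, hg] at this
    simpa using this
  · have h' : ∀ p, (f p).isRight = true := by
      push Not at h
      obtain ⟨p, hp⟩ := h
      intro q
      have := hconst p q
      rw [← Sum.not_isLeft]
      simpa using fun e => hp (this.2 e)
    choose g hg using fun p => Sum.isRight_iff.1 (h' p)
    refine Or.inr ⟨⟨g, fun {p q} hpq => ?_⟩, hg⟩
    have := f.map_adj hpq
    rw [hg, hg] at this
    simpa using this

/-- If `B` moved into `G`, then `T` would stay in `T`, and a link between them would become an edge
between `T` and `G`, of which there are none. -/
theorem isRigid_attach {T : SimpleGraph α} {G : SimpleGraph γ} {B : SimpleGraph β}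
    {s : α ⊕ γ → β → Prop} [Nonempty α]
    (hs₁ : ∀ x b b', s x b → s x b' → ¬ B.Adj b b') (hs₂ : ∀ x y b, s x b → s y b → x = y)
    (hs₃ : ∀ x, ∃ b, s x b) (hs₄ : ∀ x b, ∃ b', s x b' ∧ ¬ B.Adj b b')
    (hT : T.Preconnected) (hT' : T.EdgesInTriangles)
    (hB : B.Preconnected) (hB' : B.EdgesInTriangles) (hrigid : B.IsRigid)
    (hBT : IsEmpty (B →g T)) (hTG : IsEmpty (T →g G)) (hTB : IsEmpty (T →g B)) :
    (attach (T ⊕g G) B s).IsRigid := by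
  intro f
  let iB : B →g attach (T ⊕g G) B s := ⟨Sum.inr, fun h => h⟩
  let iW : T ⊕g G →g attach (T ⊕g G) B s := ⟨Sum.inl, fun h => h⟩
  let iT : T →g T ⊕g G := ⟨Sum.inl, fun h => by simpa using h⟩
  have hfix : ∀ b, f (.inr b) = .inr b := by
    rcases hom_attach_cases hs₁ hs₂ hB hB' (f.comp iB) with ⟨g, hg⟩ | ⟨g, hg⟩
    · exfalso
      rcases hom_sum_cases hB g with ⟨g', _⟩ | ⟨g', hg'⟩
      · exact hBT.false g'
      rcases hom_attach_cases hs₁ hs₂ hT hT' (f.comp (iW.comp iT)) with ⟨k, hk⟩ | ⟨k, _⟩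
      · rcases hom_sum_cases hT k with ⟨k', hk'⟩ | ⟨k', _⟩
        · obtain ⟨x⟩ := ‹Nonempty α›
          obtain ⟨b, hb⟩ := hs₃ (.inl x)
          have hadj : (attach (T ⊕g G) B s).Adj (.inl (.inl x)) (.inr b) := hb
          have h₁ : f (.inl (.inl x)) = .inl (.inl (k' x)) := by
            rw [← hk']
            exact hk x
          have h₂ : f (.inr b) = .inl (.inr (g' b)) := by
            rw [← hg']
            exact hg b
          have := f.map_adj hadj
          rw [h₁, h₂] at this
          have h : (T ⊕g G).Adj (.inl (k' x)) (.inr (g' b)) := this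
          simp at h
        · exact hTG.false k'
      · exact hTB.false k
    · intro b
      have e : g b = b := by rw [hrigid g]; rfl
      exact (hg b).trans (congrArg Sum.inr e)
  ext x
  rcases x with x | b
  · change f (.inl x) = .inl x
    have hadj : ∀ b, s x b → (attach (T ⊕g G) B s).Adj (f (.inl x)) (.inr b) := by
      intro b hb
      rw [← hfix b]
      exact f.map_adj (show (attach (T ⊕g G) B s).Adj (.inl x) (.inr b) from hb)
    rcases h : f (.inl x) with y | c
    · obtain ⟨b, hb⟩ := hs₃ x
      have := hadj b hb
      rw [h] at this
      rw [hs₂ y x b this hb]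
    · obtain ⟨b, hb, hcb⟩ := hs₄ x c
      have := hadj b hb
      rw [h] at this
      exact (hcb this).elim
  · exact hfix b

theorem not_isContained_top_sum {G : SimpleGraph α} {H : SimpleGraph β}
    (hG : ¬ (⊤ : SimpleGraph ℕ).IsContained G) (hH : ¬ (⊤ : SimpleGraph ℕ).IsContained H) :
    ¬ (⊤ : SimpleGraph ℕ).IsContained (G ⊕g H) := by
  rintro ⟨c⟩
  rcases hom_sum_cases preconnected_top c.toHom with ⟨g, _⟩ | ⟨g, _⟩
  · exact hG ⟨⟨g, Hom.injective_of_top_hom g⟩⟩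
  · exact hH ⟨⟨g, Hom.injective_of_top_hom g⟩⟩

end Attach

/-! ### The rigid extension -/

/-- Attach the element of index `k` to two distant vertices of the layered graph. -/
def layeredGraph.attachment (k : ℕ) (b : LayeredVertex) : Prop :=
  b = vertex (6 * k + 1) 1 (by omega) ∨ b = vertex (6 * k + 4) 1 (by omega)

end SimpleGraph

open SimpleGraph in
theorem theorem4 {V : Type u} [Countable V] (G : SimpleGraph V)
    (hG : ¬ (⊤ : SimpleGraph ℕ).IsContained G) :
    ∃ (V' : Type u) (_ : Countable V') (G' : SimpleGraph V'),
      G'.IsRigid ∧ G.IsIndContained G' := by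
  have hH := not_isContained_top_sum hG layeredGraph.not_isContained_top
  let T := (G ⊕g layeredGraph).cliqueTree
  obtain ⟨k, hk⟩ := exists_injective_nat
    (Option {l : List (V ⊕ LayeredVertex) // l.Pairwise (G ⊕g layeredGraph).Adj} ⊕ V)
  -- Residues 1 and 4 modulo 6 keep link ends distinct. Layers 3 apart, with index 1 avoiding the
  -- hub, leave each pair without an edge or a common neighbour.
  let s := fun x => layeredGraph.attachment (k x)
  let iG : G →g G ⊕g layeredGraph := ⟨Sum.inl, fun h => by simpa using h⟩
  let iB : layeredGraph →g G ⊕g layeredGraph := ⟨Sum.inr, fun h => by simpa using h⟩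
  have hT := cliqueTree_isEmpty_hom hH
  refine ⟨_, inferInstance, attach (T ⊕g G) layeredGraph s, ?_, ⟨⟨⟨fun v => .inl (.inr v), ?_⟩, ?_⟩⟩⟩
  · refine isRigid_attach ?_ ?_ ?_ ?_ (cliqueTree_preconnected _) (cliqueTree_edgesInTriangles _)
      layeredGraph.preconnected layeredGraph.edgesInTriangles layeredGraph.isRigid
      (layeredGraph.isEmpty_hom_cliqueTree hH) ⟨fun g => hT.false (iG.comp g)⟩
      ⟨fun g => hT.false (iB.comp g)⟩
    · rintro x b b' (rfl | rfl) (rfl | rfl) <;> rw [layeredGraph.adj_vertex] <;> omega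
    · rintro x y b (rfl | rfl) (h | h) <;> rw [layeredGraph.vertex_inj] at h <;>
        exact hk (by omega)
    · exact fun x => ⟨_, Or.inl rfl⟩
    · intro x b
      by_contra! h
      have h₁ := h _ (Or.inl rfl)
      have h₂ := h _ (Or.inr rfl)
      rcases layeredGraph.eq_none_or_vertex b with rfl | ⟨n, i, hi, rfl⟩
      · rw [layeredGraph.adj_none_vertex] at h₁
        omega
      · rw [layeredGraph.adj_vertex] at h₁ h₂
        omega
  · intro a b h
    simpa using h
  · intro a b
    change (T ⊕g G).Adj (.inr a) (.inr b) ↔ _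
    simp
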